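/- Let $\mathrm{SE}(2)=\mathbb{R}^2\rtimes \mathrm{SO}(2)$ be the Lie group of orientation-preserving isometries of the Euclidean plane, acting on itself by left multiplication. Let $M$ be a smooth manifold (without boundary) with a smooth left action of $\mathrm{SE}(2)$, and let $p_1,p_2\colon \mathrm{SE}(2)\to M$ be $\mathrm{SE}(2)$-equivariant surjective smooth submersions. Let $$P=\mathrm{SE}(2)\times_M \mathrm{SE}(2)=\{(g_1,g_2)\in \mathrm{SE}(2)\times \mathrm{SE}(2) : p_1(g_1)=p_2(g_2)\}$$ be their fibre product, with its smooth structure as the pullback in the category of smooth manifolds and with the diagonal action $g\cdot(g_1,g_2)=(gg_1,gg_2)$. Then there is no $\mathrm{SE}(2)$-equivariant diffeomorphism from $P$ to $\mathrm{SE}(2)\times\mathbb{R}\times S^1$, where $\mathrm{SE}(2)$ acts on the latter by left multiplication on the first factor. -/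

import Mathlib

open Set Manifold
open scoped Manifold ContDiff Topology

noncomputable section

/-! ### The special Euclidean group of the plane -/

/-- The special Euclidean group `SE(2) = ℝ² ⋊ SO(2)` of orientation preserving isometries of the
Euclidean plane. The plane is `ℂ`, a rotation is a unit complex number, and the pair `(v, θ)` is the
isometry `x ↦ θ x + v`. -/
def SE2 : Type := ℂ × Circle

namespace SE2

/-- The translation part, i.e. the image of the origin. -/
def trans (g : SE2) : ℂ := g.1

/-- The rotation part. -/
def rot (g : SE2) : Circle := g.2

/-- The element `x ↦ θ x + v`. -/
def mk (v : ℂ) (θ : Circle) : SE2 := (v, θ)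

@[ext] theorem ext {g h : SE2} (h₁ : g.trans = h.trans) (h₂ : g.rot = h.rot) : g = h :=
  Prod.ext h₁ h₂

/-- Composition of isometries: `x ↦ θ (θ' x + v') + v = θ θ' x + (v + θ v')`. -/
instance : Mul SE2 := ⟨fun g h => mk (g.trans + g.rot * h.trans) (g.rot * h.rot)⟩
instance : One SE2 := ⟨mk 0 1⟩
instance : Inv SE2 := ⟨fun g => mk (-((g.rot⁻¹ : Circle) * g.trans)) g.rot⁻¹⟩

@[simp] theorem trans_mul (g h : SE2) : (g * h).trans = g.trans + g.rot * h.trans := rfl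
@[simp] theorem rot_mul (g h : SE2) : (g * h).rot = g.rot * h.rot := rfl
@[simp] theorem trans_one : (1 : SE2).trans = 0 := rfl
@[simp] theorem rot_one : (1 : SE2).rot = 1 := rfl
@[simp] theorem trans_inv (g : SE2) : (g⁻¹).trans = -((g.rot⁻¹ : Circle) * g.trans) := rfl
@[simp] theorem rot_inv (g : SE2) : (g⁻¹).rot = g.rot⁻¹ := rfl

instance : Group SE2 :=
  Group.ofLeftAxioms
    (fun a b c => by ext1 <;> simp [mul_assoc, mul_add, add_assoc])
    (fun a => by ext1 <;> simp)
    (fun a => by ext1 <;> simp)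

/-! The smooth structure is that of the product manifold `ℂ × S¹`. -/

instance : TopologicalSpace SE2 := inferInstanceAs (TopologicalSpace (ℂ × Circle))

instance : ChartedSpace (ModelProd ℂ (EuclideanSpace ℝ (Fin 1))) SE2 :=
  inferInstanceAs (ChartedSpace (ModelProd ℂ (EuclideanSpace ℝ (Fin 1))) (ℂ × Circle))

/-- The (boundaryless, three-dimensional) model of `SE(2)`. -/
abbrev model : ModelWithCorners ℝ (ℂ × EuclideanSpace ℝ (Fin 1))
    (ModelProd ℂ (EuclideanSpace ℝ (Fin 1))) := 𝓘(ℝ, ℂ).prod (𝓡 1)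

instance : IsManifold model ∞ SE2 :=
  inferInstanceAs (IsManifold (𝓘(ℝ, ℂ).prod (𝓡 1)) ∞ (ℂ × Circle))

theorem contMDiff_trans : ContMDiff model 𝓘(ℝ, ℂ) ∞ trans :=
  (contMDiff_fst : ContMDiff (𝓘(ℝ, ℂ).prod (𝓡 1)) 𝓘(ℝ, ℂ) ∞ (Prod.fst : ℂ × Circle → ℂ))

theorem contMDiff_rot : ContMDiff model (𝓡 1) ∞ rot :=
  (contMDiff_snd : ContMDiff (𝓘(ℝ, ℂ).prod (𝓡 1)) (𝓡 1) ∞ (Prod.snd : ℂ × Circle → Circle))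

theorem contMDiff_circle_coe : ContMDiff (𝓡 1) 𝓘(ℝ, ℂ) ∞ (fun z : Circle => (z : ℂ)) := by
  have : Fact (Module.finrank ℝ ℂ = 1 + 1) := finrank_real_complex_fact'
  exact (contMDiff_coe_sphere : ContMDiff (𝓡 1) 𝓘(ℝ, ℂ) ∞
    (fun z : Metric.sphere (0 : ℂ) 1 => (z : ℂ)))

theorem contMDiff_mk {E H N : Type*} [NormedAddCommGroup E] [NormedSpace ℝ E] [TopologicalSpace H]
    {I : ModelWithCorners ℝ E H} [TopologicalSpace N] [ChartedSpace H N]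
    {v : N → ℂ} {θ : N → Circle}
    (hv : ContMDiff I 𝓘(ℝ, ℂ) ∞ v) (hθ : ContMDiff I (𝓡 1) ∞ θ) :
    ContMDiff I model ∞ (fun x => mk (v x) (θ x)) :=
  (hv.prodMk hθ : ContMDiff I (𝓘(ℝ, ℂ).prod (𝓡 1)) ∞ (fun x => (v x, θ x)))

theorem contMDiff_complex_mul {E H N : Type*} [NormedAddCommGroup E] [NormedSpace ℝ E]
    [TopologicalSpace H] {I : ModelWithCorners ℝ E H} [TopologicalSpace N] [ChartedSpace H N]
    {f g : N → ℂ} (hf : ContMDiff I 𝓘(ℝ, ℂ) ∞ f) (hg : ContMDiff I 𝓘(ℝ, ℂ) ∞ g) :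
    ContMDiff I 𝓘(ℝ, ℂ) ∞ (fun x => f x * g x) := by
  have h : ContDiff ℝ ∞ (fun z : ℂ × ℂ => z.1 * z.2) := contDiff_mul
  exact h.contMDiff.comp (hf.prodMk_space hg)

instance : LieGroup model ∞ SE2 where
  contMDiff_mul := by
    have h₁ : ContMDiff (model.prod model) 𝓘(ℝ, ℂ) ∞ (fun p : SE2 × SE2 => p.1.trans) :=
      contMDiff_trans.comp contMDiff_fst
    have h₂ : ContMDiff (model.prod model) 𝓘(ℝ, ℂ) ∞ (fun p : SE2 × SE2 => p.2.trans) :=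
      contMDiff_trans.comp contMDiff_snd
    have h₃ : ContMDiff (model.prod model) (𝓡 1) ∞ (fun p : SE2 × SE2 => p.1.rot) :=
      contMDiff_rot.comp contMDiff_fst
    have h₄ : ContMDiff (model.prod model) (𝓡 1) ∞ (fun p : SE2 × SE2 => p.2.rot) :=
      contMDiff_rot.comp contMDiff_snd
    exact contMDiff_mk (h₁.add (contMDiff_complex_mul (contMDiff_circle_coe.comp h₃) h₂))
      (h₃.mul h₄)
  contMDiff_inv := by
    have h : ContMDiff model (𝓡 1) ∞ (fun g : SE2 => g.rot⁻¹) := contMDiff_rot.inv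
    exact contMDiff_mk (contMDiff_complex_mul (contMDiff_circle_coe.comp h) contMDiff_trans).neg h

end SE2

/-! ### The fibre product of a submersion and a smooth map -/

section FibreProduct

set_option linter.unusedSectionVars false

variable {E F H K : Type*} {E₀ : Type*} [NormedAddCommGroup E₀] [NormedSpace ℝ E₀]
  [NormedAddCommGroup E] [NormedSpace ℝ E] [NormedAddCommGroup F] [NormedSpace ℝ F]
  [TopologicalSpace H] [TopologicalSpace K] {H₀ : Type*} [TopologicalSpace H₀]
  {I : ModelWithCorners ℝ E₀ H₀} {I' : ModelWithCorners ℝ E H} {J : ModelWithCorners ℝ F K}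
  {A B C : Type*} [TopologicalSpace A] [ChartedSpace H₀ A] [TopologicalSpace B] [ChartedSpace H B]
  [TopologicalSpace C] [ChartedSpace K C] {f : A → C} {g : B → C}

/-- The fibre product `A ×_C B = {(a, b) | f a = g b}` of a smooth submersion `f : A → C` and a
smooth map `g : B → C`, as a subset of `A × B`. -/
@[ext] structure FibreProduct (hf : IsSubmersion I J ∞ f) (hg : ContMDiff I' J ∞ g) where
  /-- The inclusion in the product manifold. -/
  incl : A × B
  incl_prop : f incl.1 = g incl.2

namespace FibreProduct

variable {hf : IsSubmersion I J ∞ f} {hg : ContMDiff I' J ∞ g}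

/-- The subspace topology. -/
instance : TopologicalSpace (FibreProduct hf hg) := .induced incl inferInstance

theorem incl_injective : Function.Injective (incl : FibreProduct hf hg → A × B) :=
  fun _ _ h => FibreProduct.ext h

theorem isInducing_incl : Topology.IsInducing (incl : FibreProduct hf hg → A × B) := ⟨rfl⟩

theorem continuous_incl : Continuous (incl : FibreProduct hf hg → A × B) :=
  isInducing_incl.continuous

variable (hf) in
/-- The submersion `f` in local form: near `a` there are charts of `A` and `C` and a splitting of
the model space of `A` in which `f` is a projection `(u, v) ↦ u`. -/
theorem localForm (a : A) : IsSubmersionAtOfComplement hf.complement I J ∞ f a :=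
  hf.isSubmersionOfComplement_complement a

variable (g hf) in
/-- `(v, b) ↦ (a, b)`, where `a` is the point near `a₀` with `f a = g b` and with `v` as its
coordinate along the fibre of `f`. -/
def param (a₀ : A) (y : hf.complement × B) : A × B :=
  (((localForm hf a₀).domChart.extend I).symm ((localForm hf a₀).equiv.symm
    ((localForm hf a₀).codChart.extend J (g y.2), y.1)), y.2)

variable (g hf) in
/-- The domain of the local parametrisation. -/
def paramSource (a₀ : A) : Set (hf.complement × B) :=
  {y | g y.2 ∈ (localForm hf a₀).codChart.source ∧
    (localForm hf a₀).equiv.symm ((localForm hf a₀).codChart.extend J (g y.2), y.1) ∈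
      ((localForm hf a₀).domChart.extend I).target}

variable (B hf) in
/-- `(a, b) ↦ (v, b)`, where `v` is the coordinate of `a` along the fibre of `f`. -/
def coord (a₀ : A) (x : A × B) : hf.complement × B :=
  (((localForm hf a₀).equiv ((localForm hf a₀).domChart.extend I x.1)).2, x.2)

theorem param_mem {a₀ : A} {y : hf.complement × B} (hy : y ∈ paramSource g hf a₀) :
    (param g hf a₀ y).1 ∈ (localForm hf a₀).domChart.source := by
  have := ((localForm hf a₀).domChart.extend I).map_target hy.2
  rwa [OpenPartialHomeomorph.extend_source] at this

theorem f_param {a₀ : A} {y : hf.complement × B} (hy : y ∈ paramSource g hf a₀) :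
    f (param g hf a₀ y).1 = g y.2 := by
  have h₁ := (localForm hf a₀).writtenInCharts hy.2
  have h₂ := (localForm hf a₀).mapsto_domChart_source_codChart_source (param_mem hy)
  simp only [Function.comp_apply, ContinuousLinearEquiv.apply_symm_apply] at h₁
  refine ((localForm hf a₀).codChart.extend J).injOn ?_ ?_ h₁
  · rwa [OpenPartialHomeomorph.extend_source]
  · rw [OpenPartialHomeomorph.extend_source]; exact hy.1

theorem coord_param {a₀ : A} {y : hf.complement × B} (hy : y ∈ paramSource g hf a₀) :
    coord B hf a₀ (param g hf a₀ y) = y := by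
  have h := ((localForm hf a₀).domChart.extend I).right_inv hy.2
  simp only [coord, param, h, ContinuousLinearEquiv.apply_symm_apply]

theorem splitting {a₀ : A} {x : A × B} (hx : f x.1 = g x.2)
    (hs : x.1 ∈ (localForm hf a₀).domChart.source) :
    (localForm hf a₀).equiv.symm ((localForm hf a₀).codChart.extend J (g x.2),
      ((localForm hf a₀).equiv ((localForm hf a₀).domChart.extend I x.1)).2) =
        (localForm hf a₀).domChart.extend I x.1 := by
  have hs' : x.1 ∈ ((localForm hf a₀).domChart.extend I).source := by
    rwa [OpenPartialHomeomorph.extend_source]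
  have h₁ := (localForm hf a₀).writtenInCharts
    (((localForm hf a₀).domChart.extend I).map_source hs')
  simp only [Function.comp_apply] at h₁
  rw [((localForm hf a₀).domChart.extend I).left_inv hs', hx] at h₁
  rw [ContinuousLinearEquiv.symm_apply_eq, h₁]

theorem coord_mem {a₀ : A} {x : A × B} (hx : f x.1 = g x.2)
    (hs : x.1 ∈ (localForm hf a₀).domChart.source) : coord B hf a₀ x ∈ paramSource g hf a₀ := by
  have hs' : x.1 ∈ ((localForm hf a₀).domChart.extend I).source := by
    rwa [OpenPartialHomeomorph.extend_source]
  refine ⟨?_, ?_⟩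
  · have := (localForm hf a₀).mapsto_domChart_source_codChart_source hs
    rwa [hx] at this
  · have := splitting hx hs
    simp only [coord]
    rw [this]
    exact ((localForm hf a₀).domChart.extend I).map_source hs'

theorem param_coord {a₀ : A} {x : A × B} (hx : f x.1 = g x.2)
    (hs : x.1 ∈ (localForm hf a₀).domChart.source) :
    param g hf a₀ (coord B hf a₀ x) = x := by
  have hs' : x.1 ∈ ((localForm hf a₀).domChart.extend I).source := by
    rwa [OpenPartialHomeomorph.extend_source]
  have := splitting hx hs
  simp only [coord, param]
  rw [this, ((localForm hf a₀).domChart.extend I).left_inv hs']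

theorem contMDiffOn_coord (a₀ : A) :
    ContMDiffOn (I.prod I') (𝓘(ℝ, hf.complement).prod I') ∞ (coord B hf a₀)
      {x | x.1 ∈ (localForm hf a₀).domChart.source} := by
  have h₁ : ContMDiffOn (I.prod I') 𝓘(ℝ, E₀) ∞
      (fun x : A × B => (localForm hf a₀).domChart.extend I x.1)
      {x | x.1 ∈ (localForm hf a₀).domChart.source} :=
    ((localForm hf a₀).domChart.contMDiffOn_extend
      (localForm hf a₀).domChart_mem_maximalAtlas).comp contMDiffOn_fst (fun _ hx => hx)
  have h₂ : ContDiff ℝ ∞ (fun e : E₀ => ((localForm hf a₀).equiv e).2) :=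
    contDiff_snd.comp (localForm hf a₀).equiv.contDiff
  exact (h₂.contMDiff.comp_contMDiffOn h₁).prodMk contMDiffOn_snd

theorem contMDiffOn_split (hg : ContMDiff I' J ∞ g) (a₀ : A) :
    ContMDiffOn (𝓘(ℝ, hf.complement).prod I') 𝓘(ℝ, E₀) ∞
      (fun y : hf.complement × B => (localForm hf a₀).equiv.symm
        ((localForm hf a₀).codChart.extend J (g y.2), y.1))
      {y | g y.2 ∈ (localForm hf a₀).codChart.source} := by
  have h₁ : ContMDiffOn (𝓘(ℝ, hf.complement).prod I') 𝓘(ℝ, F) ∞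
      (fun y : hf.complement × B => (localForm hf a₀).codChart.extend J (g y.2))
      {y | g y.2 ∈ (localForm hf a₀).codChart.source} :=
    ((localForm hf a₀).codChart.contMDiffOn_extend
      (localForm hf a₀).codChart_mem_maximalAtlas).comp
        (hg.comp contMDiff_snd).contMDiffOn (fun _ hx => hx)
  exact (localForm hf a₀).equiv.symm.contDiff.contMDiff.comp_contMDiffOn
    (h₁.prodMk_space contMDiffOn_fst)

theorem contMDiffOn_param (hg : ContMDiff I' J ∞ g) (a₀ : A) :
    ContMDiffOn (𝓘(ℝ, hf.complement).prod I') (I.prod I') ∞ (param g hf a₀)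
      (paramSource g hf a₀) := by
  have h₁ := (contMDiffOn_split (hf := hf) hg a₀).mono
    (t := paramSource g hf a₀) (fun y hy => hy.1)
  have h₂ := contMDiffOn_extend_symm (I := I) (localForm hf a₀).domChart_mem_maximalAtlas
  refine ContMDiffOn.prodMk (h₂.comp h₁ (fun y hy => ?_)) contMDiffOn_snd
  have h₃ := hy.2
  rw [OpenPartialHomeomorph.extend_target] at h₃
  exact ⟨_, h₃.1, I.right_inv h₃.2⟩

variable [I.Boundaryless]

theorem isOpen_paramSource (hg : ContMDiff I' J ∞ g) (a₀ : A) :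
    IsOpen (paramSource g hf a₀) := by
  have h₁ : IsOpen {y : hf.complement × B | g y.2 ∈ (localForm hf a₀).codChart.source} :=
    (localForm hf a₀).codChart.open_source.preimage (hg.continuous.comp continuous_snd)
  exact (contMDiffOn_split hg a₀).continuousOn.isOpen_inter_preimage h₁
    ((localForm hf a₀).domChart.isOpen_extend_target)

/-- Near `x₀`, the fibre product is parametrised by `(v, b)`, with `v` the coordinate of the first
component along the fibre of `f`, and `b` the second component. -/
def localTriv (x₀ : FibreProduct hf hg) :
    OpenPartialHomeomorph (FibreProduct hf hg) (hf.complement × B) where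
  toFun x := coord B hf x₀.incl.1 x.incl
  invFun y := by
    classical
    exact if h : f (param g hf x₀.incl.1 y).1 = g y.2 then ⟨param g hf x₀.incl.1 y, h⟩ else x₀
  source := {x | x.incl.1 ∈ (localForm hf x₀.incl.1).domChart.source}
  target := paramSource g hf x₀.incl.1
  map_source' x hx := coord_mem x.incl_prop hx
  map_target' y hy := by
    have h : f (param g hf x₀.incl.1 y).1 = g y.2 := f_param hy
    simp only [dif_pos h]
    exact param_mem hy
  left_inv' x hx := by
    have h : param g hf x₀.incl.1 (coord B hf x₀.incl.1 x.incl) = x.incl :=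
      param_coord x.incl_prop hx
    have h' : f (param g hf x₀.incl.1 (coord B hf x₀.incl.1 x.incl)).1 = g x.incl.2 := by
      rw [h]; exact x.incl_prop
    rw [dif_pos (show _ = g (coord B hf x₀.incl.1 x.incl).2 from h')]
    exact incl_injective h
  right_inv' y hy := by
    have h : f (param g hf x₀.incl.1 y).1 = g y.2 := f_param hy
    simp only [dif_pos h]
    exact coord_param hy
  open_source := (localForm hf x₀.incl.1).domChart.open_source.preimage
    (continuous_fst.comp continuous_incl)
  open_target := isOpen_paramSource hg _
  continuousOn_toFun := (contMDiffOn_coord (I' := I') (B := B) x₀.incl.1).continuousOn.comp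
    continuous_incl.continuousOn (fun _ hx => hx)
  continuousOn_invFun := by
    refine isInducing_incl.continuousOn_iff.2 ?_
    refine (contMDiffOn_param hg x₀.incl.1).continuousOn.congr (fun y hy => ?_)
    have h : f (param g hf x₀.incl.1 y).1 = g y.2 := f_param hy
    simp only [Function.comp_apply, dif_pos h]

theorem incl_localTriv_symm (x₀ : FibreProduct hf hg) {y : hf.complement × B}
    (hy : y ∈ paramSource g hf x₀.incl.1) :
    ((localTriv x₀).symm y).incl = param g hf x₀.incl.1 y := by
  have h : f (param g hf x₀.incl.1 y).1 = g y.2 := f_param hy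
  simp only [localTriv, OpenPartialHomeomorph.coe_mk_symm, PartialEquiv.coe_symm_mk, dif_pos h]

/-- The chart near `x₀`. -/
def chart (x₀ : FibreProduct hf hg) :
    OpenPartialHomeomorph (FibreProduct hf hg) (ModelProd hf.complement H) :=
  (localTriv x₀).trans ((OpenPartialHomeomorph.refl hf.complement).prod (chartAt H x₀.incl.2))

instance : ChartedSpace (ModelProd hf.complement H) (FibreProduct hf hg) where
  atlas := range chart
  chartAt := chart
  mem_chart_source x := by
    simp only [chart, OpenPartialHomeomorph.trans_source, mem_inter_iff, mem_preimage]
    refine ⟨(localForm hf x.incl.1).mem_domChart_source, ?_⟩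
    simp only [OpenPartialHomeomorph.prod_source, OpenPartialHomeomorph.refl_source, mem_prod,
      mem_univ, true_and]
    exact mem_chart_source H x.incl.2
  chart_mem_atlas x := mem_range_self x

/-- The chart near `x₀` extends to a smooth map on an open subset of `A × B`. -/
def extendedChart (x₀ : FibreProduct hf hg) (x : A × B) : ModelProd hf.complement H :=
  ((coord B hf x₀.incl.1 x).1, chartAt H x₀.incl.2 x.2)

theorem chart_apply (x₀ x : FibreProduct hf hg) : chart x₀ x = extendedChart x₀ x.incl := rfl

/-- The open subset of `A × B` on which the extended chart is defined. -/
def extendedChartSource (x₀ : FibreProduct hf hg) : Set (A × B) :=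
  {x | x.1 ∈ (localForm hf x₀.incl.1).domChart.source ∧ x.2 ∈ (chartAt H x₀.incl.2).source}

theorem mem_chart_source_iff (x₀ x : FibreProduct hf hg) :
    x ∈ (chart x₀).source ↔ x.incl ∈ extendedChartSource x₀ := by
  simp only [chart, OpenPartialHomeomorph.trans_source, mem_inter_iff, mem_preimage,
    OpenPartialHomeomorph.prod_source, OpenPartialHomeomorph.refl_source, mem_prod,
    mem_univ, true_and]
  rfl

/-- The model of the fibre product of `f : A → C` and `g : B → C`: the model space of a fibre of
`f` times the model of `B`. -/
abbrev model (hf : IsSubmersion I J ∞ f) (I' : ModelWithCorners ℝ E H) :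
    ModelWithCorners ℝ (hf.complement × E) (ModelProd hf.complement H) :=
  𝓘(ℝ, hf.complement).prod I'

section Smooth

variable [IsManifold I' ∞ B]

theorem contMDiffOn_incl_chart_symm (x₀ : FibreProduct hf hg) :
    ContMDiffOn (model hf I') (I.prod I') ∞ (incl ∘ (chart x₀).symm) (chart x₀).target := by
  have h₁ : ContMDiffOn (model hf I') (𝓘(ℝ, hf.complement).prod I') ∞
      (fun y : ModelProd hf.complement H => (y.1, (chartAt H x₀.incl.2).symm y.2))
      {y | y.2 ∈ (chartAt H x₀.incl.2).target} := by
    have h : ContMDiffOn (𝓘(ℝ, hf.complement).prod I') (𝓘(ℝ, hf.complement).prod I') ∞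
        (fun y : hf.complement × H => (y.1, (chartAt H x₀.incl.2).symm y.2))
        {y | y.2 ∈ (chartAt H x₀.incl.2).target} :=
      contMDiffOn_fst.prodMk ((contMDiffOn_chart_symm (I := I') (n := ∞) (x := x₀.incl.2)).comp
        contMDiffOn_snd (fun _ hy => hy))
    rwa [chartedSpaceSelf_prod] at h
  have hsub : ∀ y ∈ (chart x₀).target, y.2 ∈ (chartAt H x₀.incl.2).target ∧
      ((y.1, (chartAt H x₀.incl.2).symm y.2) : hf.complement × B) ∈
        paramSource g hf x₀.incl.1 := by
    intro y hy
    simp only [chart, OpenPartialHomeomorph.trans_target, mem_inter_iff, mem_preimage,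
      OpenPartialHomeomorph.prod_target] at hy
    exact ⟨hy.1.2, hy.2⟩
  refine ((contMDiffOn_param hg x₀.incl.1).comp (h₁.mono fun y hy => (hsub y hy).1)
    (fun y hy => (hsub y hy).2)).congr (fun y hy => ?_)
  exact incl_localTriv_symm x₀ (hsub y hy).2

theorem contMDiffOn_extendedChart (x₀ : FibreProduct hf hg) :
    ContMDiffOn (I.prod I') (model hf I') ∞ (extendedChart x₀) (extendedChartSource x₀) := by
  have h₁ := (contMDiffOn_coord (I' := I') (B := B) (hf := hf) x₀.incl.1).mono
    (t := extendedChartSource x₀) (fun x hx => hx.1)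
  have h₂ : ContMDiffOn (I.prod I') I' ∞ (fun x : A × B => chartAt H x₀.incl.2 x.2)
      (extendedChartSource x₀) :=
    (contMDiffOn_chart (I := I') (n := ∞) (x := x₀.incl.2)).comp
      contMDiffOn_snd (fun _ hy => hy.2)
  have h₃ := (contMDiff_fst.comp_contMDiffOn h₁).prodMk h₂
  rwa [chartedSpaceSelf_prod] at h₃

instance : IsManifold (model hf I') ∞ (FibreProduct hf hg) := by
  apply isManifold_of_contDiffOn
  rintro _ _ ⟨x₀, rfl⟩ ⟨x₁, rfl⟩
  have h : ContMDiffOn (model hf I') (model hf I') ∞ ((chart x₀).symm ≫ₕ chart x₁)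
      ((chart x₀).symm ≫ₕ chart x₁).source := by
    refine (contMDiffOn_extendedChart x₁).comp
      ((contMDiffOn_incl_chart_symm x₀).mono fun y hy => ?_) (fun y hy => ?_)
    · simp only [OpenPartialHomeomorph.trans_source, OpenPartialHomeomorph.symm_source] at hy
      exact hy.1
    · simp only [OpenPartialHomeomorph.trans_source] at hy
      exact (mem_chart_source_iff x₁ _).1 hy.2
  rw [← contMDiffOn_iff_contDiffOn]
  refine (model hf I').contMDiff.comp_contMDiffOn (h.comp
    ((model hf I').contMDiffOn_symm.mono inter_subset_right) ?_)
  exact fun y hy => hy.1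

theorem contMDiff_incl :
    ContMDiff (model hf I') (I.prod I') ∞ (incl : FibreProduct hf hg → A × B) := by
  intro x
  have h₁ : ContMDiffOn (model hf I') (model hf I') ∞ (chart x) (chart x).source :=
    contMDiffOn_chart (x := x)
  have hx : x ∈ (chart x).source := mem_chart_source _ x
  refine (((contMDiffOn_incl_chart_symm x).comp h₁ fun y hy => (chart x).map_source hy).congr
    fun y hy => ?_).contMDiffAt ((chart x).open_source.mem_nhds hx)
  simp only [Function.comp_apply, (chart x).left_inv hy]

/-- The smooth structure is the one of the pullback in the category of smooth manifolds: a map to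
the fibre product is smooth if and only if both of its components are. -/
theorem contMDiff_iff {E₁ H₁ N : Type*} [NormedAddCommGroup E₁] [NormedSpace ℝ E₁]
    [TopologicalSpace H₁] {I₁ : ModelWithCorners ℝ E₁ H₁} [TopologicalSpace N] [ChartedSpace H₁ N]
    {u : N → FibreProduct hf hg} :
    ContMDiff I₁ (model hf I') ∞ u ↔
      ContMDiff I₁ I ∞ (fun y => (u y).incl.1) ∧ ContMDiff I₁ I' ∞ (fun y => (u y).incl.2) := by
  refine ⟨fun h => ⟨contMDiff_fst.comp (contMDiff_incl.comp h),
    contMDiff_snd.comp (contMDiff_incl.comp h)⟩, fun ⟨h₁, h₂⟩ y => ?_⟩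
  have h₃ : ContMDiff I₁ (I.prod I') ∞ (fun y => (u y).incl) := h₁.prodMk h₂
  have hu : Continuous u := isInducing_incl.continuous_iff.2 h₃.continuous
  have hy : u y ∈ (chart (u y)).source := mem_chart_source _ (u y)
  have h₄ : ContMDiffOn (model hf I') (model hf I') ∞ (chart (u y)).symm (chart (u y)).target :=
    contMDiffOn_chart_symm (x := u y)
  have h₅ : ContMDiffOn I₁ (model hf I') ∞ (fun z => chart (u y) (u z))
      (u ⁻¹' (chart (u y)).source) :=
    (contMDiffOn_extendedChart (u y)).comp h₃.contMDiffOn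
      (fun z hz => (mem_chart_source_iff _ _).1 hz)
  refine ((h₄.comp h₅ fun z hz => (chart (u y)).map_source hz).congr fun z hz => ?_).contMDiffAt
    (((chart (u y)).open_source.preimage hu).mem_nhds hy)
  exact ((chart (u y)).left_inv hz).symm

end Smooth

end FibreProduct

end FibreProduct

/-- The diagonal action of `SE(2)` on the fibre product of two equivariant maps
`p₁, p₂ : SE(2) → M`, where `SE(2)` acts on itself by left multiplication. -/
def FibreProduct.diagSMul {E H M : Type*} [NormedAddCommGroup E] [NormedSpace ℝ E]
    [TopologicalSpace H] {J : ModelWithCorners ℝ E H} [TopologicalSpace M] [ChartedSpace H M]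
    [MulAction SE2 M] {p₁ p₂ : SE2 → M} {h₁ : IsSubmersion SE2.model J ∞ p₁}
    {h₂ : ContMDiff SE2.model J ∞ p₂} (e₁ : ∀ g x : SE2, p₁ (g * x) = g • p₁ x)
    (e₂ : ∀ g x : SE2, p₂ (g * x) = g • p₂ x) (g : SE2) (x : FibreProduct h₁ h₂) :
    FibreProduct h₁ h₂ :=
  ⟨(g * x.incl.1, g * x.incl.2), by rw [e₁, e₂, x.incl_prop]⟩

end

/-!
Write `S` for the stabiliser of `m = p₁ 1`. Every orbit of the diagonal action on
`SE(2) ×_M SE(2)` contains exactly one pair `(1, k)`, and the `k` that occur form the fibre of `p₂`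
over `m`, which is a coset `S k₀`. So an equivariant diffeomorphism onto `SE(2) × (ℝ × S¹)` gives
a homeomorphism of `ℝ × S¹` with `S k₀` (`exists_homeomorph_fibre`), and a count of dimensions shows
that the fibres of `p₁` are two-dimensional (`finrank_complement_eq_two`). No subgroup `S` allows
this, since it would have connected image in `SO(2)`, and so be of one of three kinds
(`SE2.subgroup_trichotomy`).

* All elements of `S` are translations. By the inverse function theorem, the two-dimensional `S`
  contains all small translations (`SE2.translation_fibre_mem_nhds`), hence all translations. Then
  `S k₀` is homeomorphic to `ℂ`, and the identity of `S¹` factors through `ℂ`, which is impossible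
  because maps from `ℂ` to the circle have continuous logarithms
  (`not_leftInverse_circle_complex`).
* `S` contains no nontrivial translation. Then the rotation part embeds `S k₀` in `S¹`, but there is
  no continuous injection `ℝ × S¹ → S¹` (`not_injective_of_continuous_cylinder_circle`).
* `S` is everything. Then `M` is a point, but it has dimension `3 - 2`.
-/

open Set Manifold
open scoped Manifold ContDiff Topology

/-! ### Continuous maps out of the circle and the cylinder -/

/-- One-dimensional Borsuk–Ulam: the odd function `f z - f (-z)` on the circle has a zero. -/
theorem not_injective_of_continuous_circle_real {f : Circle → ℝ} (hf : Continuous f) :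
    ¬ Function.Injective f := by
  intro hinj
  have hg : Continuous fun z : Circle => f z - f (Circle.exp Real.pi * z) := by fun_prop
  have hpi : Circle.exp Real.pi * Circle.exp Real.pi = 1 := by
    rw [← Circle.exp_add, ← two_mul, Circle.exp_two_pi]
  have hodd : f (Circle.exp Real.pi) - f (Circle.exp Real.pi * Circle.exp Real.pi) =
      -(f 1 - f (Circle.exp Real.pi * 1)) := by
    rw [hpi, mul_one]; ring
  obtain ⟨z, hz⟩ : (0 : ℝ) ∈ range fun z : Circle => f z - f (Circle.exp Real.pi * z) := by
    rcases le_total 0 (f 1 - f (Circle.exp Real.pi * 1)) with h | h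
    · exact mem_range_of_exists_le_of_exists_ge hg
        ⟨Circle.exp Real.pi, by simp only [hodd]; linarith⟩ ⟨1, h⟩
    · exact mem_range_of_exists_le_of_exists_ge hg
        ⟨1, h⟩ ⟨Circle.exp Real.pi, by simp only [hodd]; linarith⟩
  have h₁ : z = Circle.exp Real.pi * z := hinj (sub_eq_zero.1 hz)
  have h₂ : Circle.exp Real.pi = 1 := by simpa using h₁.symm
  have h₃ := congrArg (fun z : Circle => (z : ℂ).re) h₂
  norm_num [Circle.coe_exp] at h₃

theorem surjective_of_continuous_of_injective_circle {f : Circle → Circle} (hf : Continuous f)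
    (hinj : Function.Injective f) : Function.Surjective f := by
  by_contra hsurj
  simp only [Function.Surjective, not_forall, not_exists] at hsurj
  obtain ⟨w, hw⟩ := hsurj
  -- `arg` is continuous away from `-1`, so rotate the omitted point `w` to `-1`.
  have hcont : Continuous fun z => Complex.arg (-((f z * w⁻¹ : Circle) : ℂ)) := by
    refine continuous_iff_continuousAt.2 fun z => ContinuousAt.comp (Complex.continuousAt_arg ?_)
      (by fun_prop : Continuous fun z => -((f z * w⁻¹ : Circle) : ℂ)).continuousAt
    rw [Complex.mem_slitPlane_iff_arg]
    refine ⟨fun h => hw z ?_, by simp⟩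
    have h' := Complex.norm_mul_exp_arg_mul_I (-((f z * w⁻¹ : Circle) : ℂ))
    rw [h, norm_neg, Circle.norm_coe, Complex.exp_pi_mul_I] at h'
    have : f z * w⁻¹ = 1 := Circle.ext (by simpa using h'.symm)
    exact mul_inv_eq_one.1 this
  refine not_injective_of_continuous_circle_real hcont fun z z' h => hinj ?_
  have h' : -((f z * w⁻¹ : Circle) : ℂ) = -((f z' * w⁻¹ : Circle) : ℂ) :=
    Complex.ext_norm_arg (by simp only [norm_neg, Circle.norm_coe]) h
  exact mul_right_cancel (Circle.ext (neg_injective h'))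

theorem not_injective_of_continuous_cylinder_circle {f : ℝ × Circle → Circle} (hf : Continuous f) :
    ¬ Function.Injective f := by
  intro hinj
  obtain ⟨z, hz⟩ := surjective_of_continuous_of_injective_circle
    (f := fun z => f (0, z)) (by fun_prop) (fun z z' h => (Prod.ext_iff.1 (hinj h)).2) (f (1, 1))
  exact zero_ne_one (Prod.ext_iff.1 (hinj hz)).1

/-- The identity of the circle does not factor through `ℂ`. Otherwise, the second map would lift
through `Circle.exp` to a continuous real function on `ℂ`, the composition of which with the first
map would be injective. -/
theorem not_leftInverse_circle_complex {i : Circle → ℂ} {r : ℂ → Circle} (hi : Continuous i)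
    (hr : Continuous r) : ¬ Function.LeftInverse r i := by
  intro h
  obtain ⟨e, he⟩ : ∃ e : ℝ, Circle.exp e = r 0 := ⟨_, Circle.exp_arg (r 0)⟩
  obtain ⟨L, ⟨-, hL⟩, -⟩ :=
    Circle.isCoveringMap_exp.existsUnique_continuousMap_lifts ⟨r, hr⟩ 0 e he
  have hinv : Function.LeftInverse Circle.exp (L ∘ i) := fun z => by
    have := congrFun hL (i z)
    simpa [h z] using this
  exact not_injective_of_continuous_circle_real (L.continuous.comp hi) hinv.injective

/-! ### Subgroups of the plane and of the circle -/

theorem Circle.preconnectedSpace : PreconnectedSpace Circle :=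
  (show Function.Surjective Circle.exp from fun z => ⟨_, Circle.exp_arg z⟩).denseRange
    |>.preconnectedSpace Circle.exp.continuous

/-- A connected subgroup of the circle containing some `z ≠ 1` contains, by the intermediate value
theorem for the real part, all points of an arc around `1` up to inversion, so that it is open. -/
theorem Circle.subgroup_eq_top_of_isPreconnected {K : Subgroup Circle}
    (hK : IsPreconnected (K : Set Circle)) {z : Circle} (hz : z ∈ K) (hz1 : z ≠ 1) : K = ⊤ := by
  have hre : Continuous fun z : Circle => (z : ℂ).re := by fun_prop
  have hlt : (z : ℂ).re < 1 := by
    refine lt_of_le_of_ne ((Complex.re_le_norm _).trans_eq (Circle.norm_coe z)) fun h => hz1 ?_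
    have h₁ : (z : ℂ).re * (z : ℂ).re + (z : ℂ).im * (z : ℂ).im = 1 := by
      rw [← Complex.normSq_apply, Circle.normSq_coe]
    have h₂ : (z : ℂ).im = 0 := by rw [h] at h₁; nlinarith
    exact Circle.ext (Complex.ext h h₂)
  have hsub : {w : Circle | (z : ℂ).re < (w : ℂ).re} ⊆ K := by
    intro w hw
    have hw1 : (w : ℂ).re ≤ (1 : Circle).1.re := by
      simpa using (Complex.re_le_norm w).trans_eq (Circle.norm_coe w)
    obtain ⟨k, hk, hkw⟩ := hK.intermediate_value hz K.one_mem hre.continuousOn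
      ⟨le_of_lt hw, hw1⟩
    simp only at hkw
    have h₁ : (k : ℂ).re * (k : ℂ).re + (k : ℂ).im * (k : ℂ).im = 1 := by
      rw [← Complex.normSq_apply, Circle.normSq_coe]
    have h₂ : (w : ℂ).re * (w : ℂ).re + (w : ℂ).im * (w : ℂ).im = 1 := by
      rw [← Complex.normSq_apply, Circle.normSq_coe]
    have h₃ : ((w : ℂ).im - (k : ℂ).im) * ((w : ℂ).im + (k : ℂ).im) = 0 := by
      rw [hkw] at h₁; linarith
    rcases mul_eq_zero.1 h₃ with h | h
    · rwa [show w = k from Circle.ext (Complex.ext hkw.symm (sub_eq_zero.1 h))]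
    · have : w = k⁻¹ := Circle.ext (Complex.ext (by simp [hkw])
        (by simp; linarith))
      rw [this]; exact K.inv_mem hk
  have hnhds : (K : Set Circle) ∈ 𝓝 1 :=
    Filter.mem_of_superset ((isOpen_lt continuous_const hre).mem_nhds (by simpa using hlt)) hsub
  have hopen : IsOpen (K : Set Circle) := K.isOpen_of_mem_nhds hnhds
  have := Circle.preconnectedSpace
  have hclopen : IsClopen (K : Set Circle) := ⟨K.isClosed_of_isOpen hopen, hopen⟩
  exact SetLike.coe_injective (by simpa using hclopen.eq_univ ⟨1, K.one_mem⟩)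

theorem AddSubgroup.eq_top_of_mem_nhds_zero_complex {T : AddSubgroup ℂ}
    (hT : (T : Set ℂ) ∈ 𝓝 0) : T = ⊤ := by
  have hopen : IsOpen (T : Set ℂ) := T.isOpen_of_mem_nhds hT
  have hclopen : IsClopen (T : Set ℂ) := ⟨T.isClosed_of_isOpen hopen, hopen⟩
  exact SetLike.coe_injective (by simpa using hclopen.eq_univ ⟨0, T.zero_mem⟩)

/-- A rotation invariant subgroup of the plane containing `v ≠ 0` contains all the differences
`z v - v`, the norms of which fill `[0, 2 ‖v‖]`; so it contains a ball. -/
theorem AddSubgroup.eq_top_of_circle_invariant {T : AddSubgroup ℂ}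
    (hT : ∀ (z : Circle), ∀ v ∈ T, (z : ℂ) * v ∈ T) {v : ℂ} (hv : v ∈ T) (hv0 : v ≠ 0) :
    T = ⊤ := by
  apply AddSubgroup.eq_top_of_mem_nhds_zero_complex
  have hpos : 0 < ‖v‖ := norm_pos_iff.2 hv0
  refine Filter.mem_of_superset (Metric.ball_mem_nhds 0 hpos) fun w hw => ?_
  rw [mem_ball_zero_iff] at hw
  have hcont : Continuous fun t : ℝ => ‖(Circle.exp t : ℂ) * v - v‖ := by fun_prop
  obtain ⟨t, ht⟩ : ‖w‖ ∈ range fun t : ℝ => ‖(Circle.exp t : ℂ) * v - v‖ := by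
    refine mem_range_of_exists_le_of_exists_ge hcont ⟨0, by simp⟩ ⟨Real.pi, ?_⟩
    have : (Circle.exp Real.pi : ℂ) * v - v = (-2 : ℂ) * v := by
      rw [Circle.coe_exp, Complex.exp_pi_mul_I]; ring
    simp only [this, norm_mul, norm_neg, Complex.norm_ofNat]
    linarith
  simp only at ht
  set u : ℂ := (Circle.exp t : ℂ) * v - v
  have hu : u ∈ T := T.sub_mem (hT _ v hv) hv
  rcases eq_or_ne w 0 with rfl | hw0
  · exact T.zero_mem
  have hu0 : u ≠ 0 := norm_ne_zero_iff.1 (ht ▸ norm_ne_zero_iff.2 hw0)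
  have hz : ‖w / u‖ = 1 := by rw [norm_div, ht, div_self (norm_ne_zero_iff.2 hw0)]
  have := hT ⟨w / u, mem_sphere_zero_iff_norm.2 hz⟩ u hu
  rwa [show (((⟨w / u, mem_sphere_zero_iff_norm.2 hz⟩ : Circle) : ℂ)) = w / u from rfl,
    div_mul_cancel₀ _ hu0] at this

/-! ### Subgroups of `SE(2)` -/

namespace SE2

/-- The rotation part, as a group homomorphism. -/
def rotHom : SE2 →* Circle where
  toFun := rot
  map_one' := rot_one
  map_mul' := rot_mul

@[simp] theorem trans_mk (v : ℂ) (θ : Circle) : (mk v θ).trans = v := rfl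
@[simp] theorem rot_mk (v : ℂ) (θ : Circle) : (mk v θ).rot = θ := rfl

/-- The vectors by which a subgroup of `SE(2)` translates. -/
def translations (S : Subgroup SE2) : AddSubgroup ℂ where
  carrier := {v | mk v 1 ∈ S}
  zero_mem' := S.one_mem
  add_mem' {v w} hv hw := by
    have : mk (v + w) 1 = mk v 1 * mk w 1 := by ext1 <;> simp
    simpa only [mem_ofPred_eq, this] using S.mul_mem hv hw
  neg_mem' {v} hv := by
    have : mk (-v) 1 = (mk v 1)⁻¹ := by ext1 <;> simp
    simpa only [mem_ofPred_eq, this] using S.inv_mem hv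

theorem mem_translations {S : Subgroup SE2} {v : ℂ} : v ∈ translations S ↔ mk v 1 ∈ S := Iff.rfl

/-- Conjugation by `g` rotates translation vectors by `g.rot`. -/
theorem rot_mul_mem_translations {S : Subgroup SE2} {g : SE2} (hg : g ∈ S) {v : ℂ}
    (hv : v ∈ translations S) : (g.rot : ℂ) * v ∈ translations S := by
  have : mk ((g.rot : ℂ) * v) 1 = g * mk v 1 * g⁻¹ := by
    ext1 <;> simp
  rw [mem_translations, this]
  exact S.mul_mem (S.mul_mem hg hv) (S.inv_mem hg)

/-- A subgroup of `SE(2)` with connected image in `SO(2)` consists of translations, or contains no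
nontrivial translation, or is everything: if its image is nontrivial, the image is `SO(2)`, and the
translations in the subgroup are invariant under all rotations. -/
theorem subgroup_trichotomy (S : Subgroup SE2) (hS : IsPreconnected (rot '' (S : Set SE2))) :
    (∀ h ∈ S, h.rot = 1) ∨ translations S = ⊥ ∨ S = ⊤ := by
  by_cases h1 : ∀ h ∈ S, h.rot = 1
  · exact Or.inl h1
  push Not at h1
  obtain ⟨h, hh, hrot⟩ := h1
  have htop : S.map rotHom = ⊤ :=
    Circle.subgroup_eq_top_of_isPreconnected (by rw [Subgroup.coe_map]; exact hS)
      (Subgroup.mem_map_of_mem rotHom hh) hrot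
  have hlift : ∀ z : Circle, ∃ g ∈ S, g.rot = z := fun z => by
    have : z ∈ S.map rotHom := htop ▸ Subgroup.mem_top z
    exact Subgroup.mem_map.1 this
  refine Or.inr ((eq_or_ne (translations S) ⊥).imp_right fun hT => ?_)
  obtain ⟨v, hv, hv0⟩ := (translations S).bot_or_exists_ne_zero.resolve_left hT
  have hall : translations S = ⊤ := AddSubgroup.eq_top_of_circle_invariant (fun z w hw => by
    obtain ⟨g, hg, rfl⟩ := hlift z
    exact rot_mul_mem_translations hg hw) hv hv0
  refine (Subgroup.eq_top_iff' S).2 fun g => ?_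
  obtain ⟨k, hk, hkg⟩ := hlift g.rot
  have hgk : g * k⁻¹ = mk (g * k⁻¹).trans 1 := by ext1 <;> simp [hkg]
  have hmem : g * k⁻¹ ∈ S := by
    rw [hgk, ← mem_translations, hall]; exact AddSubgroup.mem_top _
  simpa using S.mul_mem hmem hk

theorem eq_of_rot_eq_of_translations_eq_bot {S : Subgroup SE2} (hS : translations S = ⊥)
    {g h : SE2} (hgh : g * h⁻¹ ∈ S) (hrot : g.rot = h.rot) : g = h := by
  have h₁ : g * h⁻¹ = mk (g * h⁻¹).trans 1 := by ext1 <;> simp [hrot]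
  have h₂ : (g * h⁻¹).trans ∈ translations S := by rwa [mem_translations, ← h₁]
  rw [hS, AddSubgroup.mem_bot] at h₂
  rw [h₂] at h₁
  exact mul_inv_eq_one.1 h₁

end SE2

/-! ### Fibres of a submersion from `SE(2)` -/

section Fibre

variable {E H M : Type*} [NormedAddCommGroup E] [NormedSpace ℝ E] [TopologicalSpace H]
  {J : ModelWithCorners ℝ E H} [TopologicalSpace M] [ChartedSpace H M]

theorem ContinuousLinearMap.range_eq_top_of_comp_eq_id {V W : Type*} [NormedAddCommGroup V]
    [NormedSpace ℝ V] [NormedAddCommGroup W] [NormedSpace ℝ W] [FiniteDimensional ℝ V]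
    [FiniteDimensional ℝ W] (hVW : Module.finrank ℝ V = Module.finrank ℝ W) {f : V →L[ℝ] W}
    {r : W →L[ℝ] V} (h : r.comp f = ContinuousLinearMap.id ℝ V) : f.range = ⊤ := by
  have hinj : Function.Injective f.toLinearMap := fun x y hxy => by
    have hx : r (f x) = x := DFunLike.congr_fun h x
    have hy : r (f y) = y := DFunLike.congr_fun h y
    rw [← hx, ← hy]
    exact congrArg r hxy
  exact LinearMap.range_eq_top.2 ((LinearMap.injective_iff_surjective_of_finrank_eq_finrank hVW).1
    hinj)

open FibreProduct in
/-- If the fibre through `1` of a submersion with two-dimensional fibres consists of translations,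
then it contains all small translations: its local parametrisation is an immersion of a plane
into the plane of translations, so that the inverse function theorem applies. -/
theorem SE2.translation_fibre_mem_nhds {p : SE2 → M} (hp : IsSubmersion SE2.model J ∞ p)
    (hdim : Module.finrank ℝ hp.complement = 2) (hrot : ∀ h : SE2, p h = p 1 → h.rot = 1) :
    {v : ℂ | p (mk v 1) = p 1} ∈ 𝓝 0 := by
  have : FiniteDimensional ℝ hp.complement := Module.finite_of_finrank_eq_succ hdim
  have : CompleteSpace hp.complement := FiniteDimensional.complete ℝ _
  -- The fibre is parametrised by freezing the second component of the fibre product of `p` with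
  -- itself at `1`; `r` is the inverse of this parametrisation.
  set U : Set hp.complement := {y | (y, (1 : SE2)) ∈ paramSource p hp 1} with hU
  set f : hp.complement → ℂ := fun y => (param p hp 1 (y, 1)).1.trans with hf
  set r : ℂ → hp.complement := fun w => (coord SE2 hp 1 (mk w 1, 1)).1 with hr
  set y₀ : hp.complement := (coord SE2 hp 1 ((1 : SE2), (1 : SE2))).1 with hy₀
  have hdom : (1 : SE2) ∈ (localForm hp 1).domChart.source := (localForm hp 1).mem_domChart_source
  have hUo : IsOpen U :=
    (isOpen_paramSource hp.contMDiff 1).preimage (by fun_prop : Continuous fun y => (y, (1 : SE2)))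
  have hy₀U : y₀ ∈ U := coord_mem (x := ((1 : SE2), (1 : SE2))) rfl hdom
  have hf0 : f y₀ = 0 := by
    have h : param p hp 1 (y₀, 1) = (1, 1) :=
      param_coord (x := ((1 : SE2), (1 : SE2))) rfl hdom
    simp only [hf, h, trans_one]
  have hfib : ∀ y ∈ U, p (param p hp 1 (y, 1)).1 = p 1 := fun y hy => f_param hy
  have hmk : ∀ y ∈ U, mk (f y) 1 = (param p hp 1 (y, 1)).1 := fun y hy =>
    SE2.ext rfl (hrot _ (hfib y hy)).symm
  have hrf : ∀ y ∈ U, r (f y) = y := fun y hy => by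
    have h : (mk (f y) 1, (1 : SE2)) = param p hp 1 (y, 1) := Prod.ext (hmk y hy) rfl
    simp only [hr, h, coord_param hy]
  have hfs : ContDiffAt ℝ ∞ f y₀ := by
    have h₁ : ContMDiffOn 𝓘(ℝ, hp.complement) (SE2.model.prod SE2.model) ∞
        (fun y : hp.complement => param p hp 1 (y, 1)) U :=
      (contMDiffOn_param hp.contMDiff 1).comp
        (contMDiff_id.prodMk contMDiff_const).contMDiffOn fun y hy => hy
    exact ((contMDiff_trans.comp contMDiff_fst).comp_contMDiffOn h₁).contMDiffAt
      (hUo.mem_nhds hy₀U) |>.contDiffAt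
  have hrs : ContDiffAt ℝ ∞ r 0 := by
    have h₁ : ContMDiff 𝓘(ℝ, ℂ) (SE2.model.prod SE2.model) ∞ (fun w : ℂ => (mk w 1, (1 : SE2))) :=
      (contMDiff_mk contMDiff_id contMDiff_const).prodMk contMDiff_const
    have h₂ := (contMDiffOn_coord (I' := SE2.model) (B := SE2) (hf := hp) 1).comp
      (h₁.contMDiffOn (s := (fun w : ℂ => mk w 1) ⁻¹' (localForm hp 1).domChart.source))
      fun w hw => hw
    have h₃ : Continuous fun w : ℂ => mk w 1 := continuous_fst.comp h₁.continuous
    exact (contMDiff_fst.comp_contMDiffOn h₂).contMDiffAt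
      (((localForm hp 1).domChart.open_source.preimage h₃).mem_nhds hdom) |>.contDiffAt
  have hfd := hfs.hasStrictFDerivAt (by simp)
  have hrd : HasFDerivAt r (fderiv ℝ r 0) (f y₀) := by
    rw [hf0]; exact (hrs.differentiableAt (by simp)).hasFDerivAt
  have hcomp : (fderiv ℝ r 0).comp (fderiv ℝ f y₀) = ContinuousLinearMap.id ℝ hp.complement :=
    (hrd.comp y₀ hfd.hasFDerivAt).unique ((hasFDerivAt_id y₀).congr_of_eventuallyEq
      (Filter.eventually_of_mem (hUo.mem_nhds hy₀U) hrf))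
  have hmap := hfd.map_nhds_eq_of_surj (ContinuousLinearMap.range_eq_top_of_comp_eq_id
    (hdim.trans Complex.finrank_real_complex.symm) hcomp)
  rw [← hf0, ← hmap, Filter.mem_map]
  refine Filter.mem_of_superset (hUo.mem_nhds hy₀U) fun y hy => ?_
  change p (mk (f y) 1) = p 1
  rw [hmk y hy, hfib y hy]

theorem finrank_eq_zero_of_subsingleton_manifold [J.Boundaryless] [Subsingleton M] (x : M) :
    Module.finrank ℝ E = 0 := by
  rcases subsingleton_or_nontrivial E with h | h
  · exact Module.finrank_zero_of_subsingleton
  exfalso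
  have h₁ : ({extChartAt J x x} : Set E) ∈ 𝓝 (extChartAt J x x) := by
    refine Filter.mem_of_superset (extChartAt_target_mem_nhds (I := J) x) fun e he => ?_
    rw [mem_singleton_iff, ← (extChartAt J x).right_inv he]
    exact congrArg _ (Subsingleton.elim _ _)
  have := Module.punctured_nhds_neBot ℝ E (extChartAt J x x)
  have h₂ := inter_mem_nhdsWithin {extChartAt J x x}ᶜ h₁
  rw [compl_inter_self] at h₂
  exact Filter.empty_notMem _ h₂

theorem Manifold.IsSubmersion.finrank_add_finrank_complement {p : SE2 → M}
    (hp : IsSubmersion SE2.model J ∞ p) [FiniteDimensional ℝ hp.complement] :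
    Module.finrank ℝ E + Module.finrank ℝ hp.complement = 3 := by
  have e := (FibreProduct.localForm hp 1).equiv
  have : FiniteDimensional ℝ (E × hp.complement) := e.toLinearEquiv.finiteDimensional
  have : FiniteDimensional ℝ E :=
    Module.Finite.of_surjective (LinearMap.fst ℝ E hp.complement) LinearMap.fst_surjective
  have h := e.toLinearEquiv.finrank_eq
  simpa [Module.finrank_prod] using h.symm

end Fibre

/-! ### The orbit space of the fibre product -/

section Stabilizer

variable {M : Type*} [MulAction SE2 M] {p p₁ p₂ : SE2 → M}

/-- The stabiliser of `p 1`, for an equivariant map `p`. -/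
noncomputable def stabilizerAtOne (e : ∀ g x : SE2, p (g * x) = g • p x) : Subgroup SE2 :=
  (MulAction.stabilizer SE2 (p 1)).copy {g | p g = p 1} <| by
    ext g
    rw [mem_ofPred_eq, SetLike.mem_coe, MulAction.mem_stabilizer_iff, ← e, mul_one]

theorem mem_stabilizerAtOne {e : ∀ g x : SE2, p (g * x) = g • p x} {g : SE2} :
    g ∈ stabilizerAtOne e ↔ p g = p 1 := Iff.rfl

/-- The fibre of `p₂` over `p₁ 1` is a coset of the stabiliser of `p₁ 1`. -/
theorem mul_inv_mem_stabilizerAtOne_iff (e₁ : ∀ g x : SE2, p₁ (g * x) = g • p₁ x)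
    (e₂ : ∀ g x : SE2, p₂ (g * x) = g • p₂ x) {g k : SE2} (hk : p₂ k = p₁ 1) :
    g * k⁻¹ ∈ stabilizerAtOne e₁ ↔ p₂ g = p₁ 1 := by
  rw [mem_stabilizerAtOne, ← mul_one (g * k⁻¹), e₁, ← hk, ← e₂, inv_mul_cancel_right]

end Stabilizer

section Orbits

variable {E H M : Type*} [NormedAddCommGroup E] [NormedSpace ℝ E] [TopologicalSpace H]
  {J : ModelWithCorners ℝ E H} [TopologicalSpace M] [ChartedSpace H M] {p₁ p₂ : SE2 → M}

/-- A diffeomorphism of the fibre product with the five-dimensional `SE(2) × ℝ × S¹` forces the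
fibres of `p₁` to be two-dimensional. -/
theorem finrank_complement_eq_two {h₁ : IsSubmersion SE2.model J ∞ p₁}
    {h₂ : ContMDiff SE2.model J ∞ p₂}
    (Φ : FibreProduct h₁ h₂ ≃ₘ⟮FibreProduct.model h₁ SE2.model,
      SE2.model.prod (𝓘(ℝ, ℝ).prod (𝓡 1))⟯ (SE2 × ℝ × Circle)) :
    Module.finrank ℝ h₁.complement = 2 := by
  have e : (h₁.complement × (ℂ × EuclideanSpace ℝ (Fin 1))) ≃L[ℝ]
      ((ℂ × EuclideanSpace ℝ (Fin 1)) × (ℝ × EuclideanSpace ℝ (Fin 1))) :=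
    Φ.mfderivToContinuousLinearEquiv (by simp) (Φ.symm (1, 0, 1))
  have : FiniteDimensional ℝ (h₁.complement × (ℂ × EuclideanSpace ℝ (Fin 1))) :=
    e.symm.toLinearEquiv.finiteDimensional
  have : FiniteDimensional ℝ h₁.complement :=
    Module.Finite.of_surjective (LinearMap.fst ℝ h₁.complement (ℂ × EuclideanSpace ℝ (Fin 1)))
      LinearMap.fst_surjective
  have h := e.toLinearEquiv.finrank_eq
  simp only [Module.finrank_prod, Complex.finrank_real_complex, finrank_euclideanSpace,
    Fintype.card_fin, Module.finrank_self] at h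
  omega

variable [MulAction SE2 M]

/-- An equivariant homeomorphism `SE(2) ×_M SE(2) ≅ SE(2) × Y` identifies `Y` with the fibre of `p₂`
over `p₁ 1`, which represents the orbits in the fibre product by the pairs with first component
`1`. -/
theorem exists_homeomorph_fibre {Y : Type*} [TopologicalSpace Y]
    {h₁ : IsSubmersion SE2.model J ∞ p₁}
    {h₂ : ContMDiff SE2.model J ∞ p₂} (e₁ : ∀ g x : SE2, p₁ (g * x) = g • p₁ x)
    (e₂ : ∀ g x : SE2, p₂ (g * x) = g • p₂ x) (Φ : FibreProduct h₁ h₂ ≃ₜ SE2 × Y)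
    (hΦ : ∀ (g : SE2) (x : FibreProduct h₁ h₂),
      Φ (FibreProduct.diagSMul e₁ e₂ g x) = (g * (Φ x).1, (Φ x).2)) :
    Nonempty (Y ≃ₜ {k : SE2 // p₂ k = p₁ 1}) := by
  have : IsTopologicalGroup SE2 := topologicalGroup_of_lieGroup SE2.model ∞
  have hmem (y : Y) : p₂ ((Φ.symm (1, y)).incl.1⁻¹ * (Φ.symm (1, y)).incl.2) = p₁ 1 := by
    rw [e₂, ← (Φ.symm (1, y)).incl_prop, ← e₁, inv_mul_cancel]
  let q (k : {k : SE2 // p₂ k = p₁ 1}) : FibreProduct h₁ h₂ := ⟨(1, k), k.2.symm⟩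
  have hq : Continuous q := by
    refine FibreProduct.isInducing_incl.continuous_iff.2 ?_
    exact continuous_const.prodMk continuous_subtype_val
  have hincl : Continuous fun y : Y => (Φ.symm (1, y)).incl :=
    FibreProduct.continuous_incl.comp (Φ.symm.continuous.comp (by fun_prop))
  refine ⟨⟨⟨fun y => ⟨_, hmem y⟩, fun k => (Φ (q k)).2, fun y => ?_, fun k => ?_⟩, ?_, ?_⟩⟩
  · have h : q ⟨_, hmem y⟩ =
        FibreProduct.diagSMul e₁ e₂ (Φ.symm (1, y)).incl.1⁻¹ (Φ.symm (1, y)) :=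
      FibreProduct.incl_injective (Prod.ext (inv_mul_cancel _).symm rfl)
    simp only [h, hΦ, Homeomorph.apply_symm_apply]
  · have h : Φ.symm (1, (Φ (q k)).2) = FibreProduct.diagSMul e₁ e₂ (Φ (q k)).1⁻¹ (q k) := by
      rw [Homeomorph.symm_apply_eq, hΦ, inv_mul_cancel]
    apply Subtype.ext
    simp [h, FibreProduct.diagSMul, q]
  · exact ((continuous_fst.comp hincl).inv.mul (continuous_snd.comp hincl)).subtype_mk _
  · exact continuous_snd.comp (Φ.continuous.comp hq)

/-- The fibre of `p₂` over `p₁ 1` is not a cylinder if it is two-dimensional. -/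
theorem not_homeomorph_cylinder_fibre [J.Boundaryless] (h₁ : IsSubmersion SE2.model J ∞ p₁)
    (surj₁ : Function.Surjective p₁) (e₁ : ∀ g x : SE2, p₁ (g * x) = g • p₁ x)
    (e₂ : ∀ g x : SE2, p₂ (g * x) = g • p₂ x) (hdim : Module.finrank ℝ h₁.complement = 2)
    (Ψ : ℝ × Circle ≃ₜ {k : SE2 // p₂ k = p₁ 1}) : False := by
  have : IsTopologicalGroup SE2 := topologicalGroup_of_lieGroup SE2.model ∞
  have := Circle.preconnectedSpace
  have hrotc : Continuous SE2.rot := SE2.contMDiff_rot.continuous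
  have hΨ : Continuous fun y => (Ψ y : SE2) := continuous_subtype_val.comp Ψ.continuous
  set k₀ := Ψ (0, 1)
  have hconn : IsPreconnected (SE2.rot '' (stabilizerAtOne e₁ : Set SE2)) := by
    have h : SE2.rot '' (stabilizerAtOne e₁ : Set SE2) =
        range fun y => ((Ψ y : SE2) * (k₀ : SE2)⁻¹).rot := by
      ext z
      refine ⟨?_, ?_⟩
      · rintro ⟨g, hg, rfl⟩
        have hgk : p₂ (g * k₀) = p₁ 1 :=
          (mul_inv_mem_stabilizerAtOne_iff e₁ e₂ k₀.2).1 (by rwa [mul_inv_cancel_right])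
        exact ⟨Ψ.symm ⟨g * k₀, hgk⟩, by simp⟩
      · rintro ⟨y, rfl⟩
        exact ⟨_, (mul_inv_mem_stabilizerAtOne_iff e₁ e₂ k₀.2).2 (Ψ y).2, rfl⟩
    rw [h]
    exact isPreconnected_range (hrotc.comp (hΨ.mul continuous_const))
  rcases SE2.subgroup_trichotomy _ hconn with hrot | hbot | htop
  · -- The stabiliser is the group of all translations, so that its coset is a plane.
    have hT : SE2.translations (stabilizerAtOne e₁) = ⊤ :=
      AddSubgroup.eq_top_of_mem_nhds_zero_complex
        (SE2.translation_fibre_mem_nhds h₁ hdim hrot)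
    have hmem (v : ℂ) : p₂ (SE2.mk v 1 * k₀) = p₁ 1 := by
      refine (mul_inv_mem_stabilizerAtOne_iff e₁ e₂ k₀.2).1 ?_
      rw [mul_inv_cancel_right, ← SE2.mem_translations, hT]
      exact AddSubgroup.mem_top v
    have hmk : Continuous fun v : ℂ => SE2.mk v 1 :=
      (SE2.contMDiff_mk contMDiff_id contMDiff_const : ContMDiff 𝓘(ℝ, ℂ) SE2.model ∞ _).continuous
    refine not_leftInverse_circle_complex
      (i := fun z => ((Ψ (0, z) : SE2) * (k₀ : SE2)⁻¹).trans)
      (r := fun v => (Ψ.symm ⟨_, hmem v⟩).2) ?_ ?_ fun z => ?_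
    · exact SE2.contMDiff_trans.continuous.comp
        ((hΨ.comp (by fun_prop : Continuous fun z : Circle => ((0 : ℝ), z))).mul continuous_const)
    · exact continuous_snd.comp
        (Ψ.symm.continuous.comp ((hmk.mul continuous_const).subtype_mk _))
    · have h : SE2.mk ((Ψ (0, z) : SE2) * (k₀ : SE2)⁻¹).trans 1 = Ψ (0, z) * (k₀ : SE2)⁻¹ :=
        SE2.ext rfl
          (hrot _ ((mul_inv_mem_stabilizerAtOne_iff e₁ e₂ k₀.2).2 (Ψ (0, z)).2)).symm
      simp only [h, inv_mul_cancel_right, Subtype.coe_eta, Homeomorph.symm_apply_apply]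
  · refine not_injective_of_continuous_cylinder_circle (hrotc.comp hΨ) fun y y' h => ?_
    refine Ψ.injective (Subtype.ext (SE2.eq_of_rot_eq_of_translations_eq_bot hbot ?_ h))
    exact (mul_inv_mem_stabilizerAtOne_iff e₁ e₂ (Ψ y').2).2 (Ψ y).2
  · have : FiniteDimensional ℝ h₁.complement := Module.finite_of_finrank_eq_succ hdim
    have : Subsingleton M := by
      have hconst (m : M) : m = p₁ 1 := by
        obtain ⟨g, rfl⟩ := surj₁ m
        exact mem_stabilizerAtOne.1 (htop ▸ Subgroup.mem_top g)
      exact ⟨fun m m' => (hconst m).trans (hconst m').symm⟩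
    have hE : Module.finrank ℝ E = 0 := finrank_eq_zero_of_subsingleton_manifold (J := J) (p₁ 1)
    have := h₁.finrank_add_finrank_complement
    omega

end Orbits

/-- Let `M` be a smooth `SE(2)`-manifold and `p₁, p₂ : SE(2) → M` equivariant surjective
submersions. Then `SE(2) ×_M SE(2)`, with the diagonal action, is not equivariantly diffeomorphic to
`SE(2) × ℝ × S¹`, where `SE(2)` acts on the first factor by left multiplication. -/
theorem mainTheorem6 {E H M : Type*} [NormedAddCommGroup E] [NormedSpace ℝ E]
    [TopologicalSpace H] (J : ModelWithCorners ℝ E H) [J.Boundaryless]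
    [TopologicalSpace M] [ChartedSpace H M] [IsManifold J ∞ M]
    [MulAction SE2 M] [ContMDiffSMul SE2.model J ∞ SE2 M]
    (p₁ p₂ : SE2 → M)
    (sub₁ : IsSubmersion SE2.model J ∞ p₁) (sub₂ : IsSubmersion SE2.model J ∞ p₂)
    (surj₁ : Function.Surjective p₁) (surj₂ : Function.Surjective p₂)
    (equiv₁ : ∀ g x : SE2, p₁ (g * x) = g • p₁ x)
    (equiv₂ : ∀ g x : SE2, p₂ (g * x) = g • p₂ x) :
    ¬ ∃ Φ : FibreProduct sub₁ sub₂.contMDiff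
        ≃ₘ⟮FibreProduct.model sub₁ SE2.model, SE2.model.prod (𝓘(ℝ, ℝ).prod (𝓡 1))⟯
          (SE2 × ℝ × Circle),
      ∀ (g : SE2) (x : FibreProduct sub₁ sub₂.contMDiff),
        Φ (FibreProduct.diagSMul equiv₁ equiv₂ g x) = (g * (Φ x).1, (Φ x).2) := by
  rintro ⟨Φ, hΦ⟩
  obtain ⟨Ψ⟩ := exists_homeomorph_fibre equiv₁ equiv₂ Φ.toHomeomorph hΦ
  exact not_homeomorph_cylinder_fibre sub₁ surj₁ equiv₁ equiv₂ (finrank_complement_eq_two Φ) Ψ
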